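/- Let $\mathcal X,\mathcal Y$ be finite sets and $c:\mathcal X\times\mathcal Y\to\mathbb R$ a cost function. Write $S=\mathcal X\times\mathcal Y$, and let $\Delta_S$ be the set of probability vectors on $S$. For matrices $P\in\mathbb R^{\mathcal X\times\mathcal X}$ and $Q\in\mathbb R^{\mathcal Y\times\mathcal Y}$, let $\Pi_{TC}(P,Q)$ be the set of transition matrices $R$ on $S$ such that each row $R((x,y),\cdot)\in\Delta_S$ has marginals $P(x,\cdot)$ and $Q(y,\cdot)$, i.e. $\sum_{y'}R((x,y),(x',y'))=P(x,x')$ and $\sum_{x'}R((x,y),(x',y'))=Q(y,y')$ for all $x,x'\in\mathcal X$ and $y,y'\in\mathcal Y$. For $\eta>0$ let $\Pi^\eta_{TC}(P,Q)$ be the set of those $R\in\Pi_{TC}(P,Q)$ with $\mathcal K\big(R((x,y),\cdot)\,\|\,P(x,\cdot)\otimes Q(y,\cdot)\big)\le\eta$ for all $(x,y)\in S$, where $\mathcal K(u\|v)=\sum_s u(s)\log(u(s)/v(s))$ is the Kullback--Leibler divergence (with $0\log(0/0)=0$, and $\mathcal K(u\|v)=+\infty$ if $u(s)>0=v(s)$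 for some $s$). Let $\rho(P,Q)$ be the optimal value, and $\Phi^*(P,Q)$ the set of optimal solutions $(\lambda,R)$, of the program $$\text{minimize } \langle c,\lambda\rangle\quad\text{subject to}\quad \lambda\in\Delta_S,\ R\in\Pi_{TC}(P,Q),\ \lambda R=\lambda,$$ and let $\rho_\eta(P,Q)$, $\Phi^*_\eta(P,Q)$ be the optimal value and the set of optimal solutions of the same program with $\Pi^\eta_{TC}(P,Q)$ in place of $\Pi_{TC}(P,Q)$. (An infeasible program has value $+\infty$ and no optimal solution.) For sets $A_0,A_1,\dots$ in a topological space, $\limsup_{n\to\infty}A_n:=\bigcap_{n\ge0}\operatorname{cl}\big(\bigcup_{m\ge n}A_m\big)$; pairs $(\lambda,R)$ carry the Euclidean topology of $\mathbb R^{S}\times\mathbb R^{S\times S}$. Let $X=(X_i)_{i\ge0}$ and $Y=(Y_i)_{i\ge0}$ be processes on a common probability space, with values in $\mathcal X$ and $\mathcal Y$ respectively, each of them stationary and ergodic (no Markov property and no joint stationarity is assumed). Let $$P(x,x')=\frac{\mathbb P(X_0=x,\,X_1=x')}{\mathbb P(X_0=x)},\qquad \hat P_n(x,x')=\frac{\#\{0\le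 i\le n-2: X_i=x,\,X_{i+1}=x'\}}{\#\{0\le i\le n-2: X_i=x\}}$$ be the one-step transition matrix of $X$ and its estimate by relative frequencies from the $n$ observations $X_0,\dots,X_{n-1}$, with the convention $0/0=0$, and define $Q$, $\hat Q_n$ in the same way from $Y$. Then, with probability one, the following hold: * $\rho(\hat P_n,\hat Q_n)\to\rho(P,Q)$ and $\limsup_{n\to\infty}\Phi^*(\hat P_n,\hat Q_n)\subseteq\Phi^*(P,Q)$; * for every $\eta>0$, $\rho_\eta(\hat P_n,\hat Q_n)\to\rho_\eta(P,Q)$ and $\limsup_{n\to\infty}\Phi^*_\eta(\hat P_n,\hat Q_n)\subseteq\Phi^*_\eta(P,Q)$. -/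

import Mathlib

open MeasureTheory Filter Topology

namespace OTC

section Coupling

variable {𝒳 𝒴 : Type*} [Fintype 𝒳] [Fintype 𝒴]

/-- The probability vectors on `𝒳 × 𝒴` with marginals `u` and `v`. -/
def couplings (u : 𝒳 → ℝ) (v : 𝒴 → ℝ) : Set (𝒳 × 𝒴 → ℝ) :=
  {r | r ∈ stdSimplex ℝ (𝒳 × 𝒴) ∧ (∀ x, ∑ y, r (x, y) = u x) ∧ (∀ y, ∑ x, r (x, y) = v y)}

/-- The transition couplings of `P` and `Q`: each row `R ((x, y), ·)` is a coupling of
`P (x, ·)` and `Q (y, ·)`. -/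
def transitionCouplings (P : Matrix 𝒳 𝒳 ℝ) (Q : Matrix 𝒴 𝒴 ℝ) :
    Set (Matrix (𝒳 × 𝒴) (𝒳 × 𝒴) ℝ) :=
  {R | ∀ s, R s ∈ couplings (P s.1) (Q s.2)}

open Classical in
/-- Kullback-Leibler divergence of vectors on a finite set, `+∞` if `u` charges a zero of `v`.
Real division and logarithm give the convention `0 log (0 / 0) = 0`. -/
noncomputable def klVec {S : Type*} [Fintype S] (u v : S → ℝ) : EReal :=
  if ∀ s, v s = 0 → u s = 0 then ((∑ s, u s * Real.log (u s / v s) : ℝ) : EReal) else ⊤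

/-- The independent transition coupling `P ⊗ Q`. -/
def indep (P : Matrix 𝒳 𝒳 ℝ) (Q : Matrix 𝒴 𝒴 ℝ) : Matrix (𝒳 × 𝒴) (𝒳 × 𝒴) ℝ :=
  fun s s' => P s.1 s'.1 * Q s.2 s'.2

/-- The transition couplings whose rows are within divergence `η` of those of `P ⊗ Q`. -/
def transitionCouplingsEta (η : ℝ) (P : Matrix 𝒳 𝒳 ℝ) (Q : Matrix 𝒴 𝒴 ℝ) :
    Set (Matrix (𝒳 × 𝒴) (𝒳 × 𝒴) ℝ) :=
  {R | R ∈ transitionCouplings P Q ∧ ∀ s, klVec (R s) (indep P Q s) ≤ (η : EReal)}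

end Coupling

section Program

variable {S : Type*} [Fintype S]

/-- Pairs `(lam, R)` with `R ∈ C` and `lam` a stationary distribution of `R`. -/
def feasible (C : Set (Matrix S S ℝ)) : Set ((S → ℝ) × Matrix S S ℝ) :=
  {z | z.1 ∈ stdSimplex ℝ S ∧ z.2 ∈ C ∧ Matrix.vecMul z.1 z.2 = z.1}

/-- The optimal value of: minimize `⟨c, lam⟩` over `(lam, R) ∈ feasible C`
(`+∞` if the program is infeasible). -/
noncomputable def optimalValue (c : S → ℝ) (C : Set (Matrix S S ℝ)) : EReal :=
  ⨅ z ∈ feasible C, ((c ⬝ᵥ z.1 : ℝ) : EReal)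

/-- The set of optimal solutions of: minimize `⟨c, lam⟩` over `(lam, R) ∈ feasible C`. -/
def optimalSolutions (c : S → ℝ) (C : Set (Matrix S S ℝ)) : Set ((S → ℝ) × Matrix S S ℝ) :=
  {z | z ∈ feasible C ∧ ∀ w ∈ feasible C, c ⬝ᵥ z.1 ≤ c ⬝ᵥ w.1}

end Program

section OptimalTransitionCoupling

variable {𝒳 𝒴 : Type*} [Fintype 𝒳] [Fintype 𝒴]

/-- The optimal transition coupling cost `ρ(P, Q)`. -/
noncomputable def rho (c : 𝒳 × 𝒴 → ℝ) (P : Matrix 𝒳 𝒳 ℝ) (Q : Matrix 𝒴 𝒴 ℝ) : EReal :=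
  optimalValue c (transitionCouplings P Q)

/-- The optimal solutions `Φ*(P, Q)`. -/
def PhiStar (c : 𝒳 × 𝒴 → ℝ) (P : Matrix 𝒳 𝒳 ℝ) (Q : Matrix 𝒴 𝒴 ℝ) :
    Set ((𝒳 × 𝒴 → ℝ) × Matrix (𝒳 × 𝒴) (𝒳 × 𝒴) ℝ) :=
  optimalSolutions c (transitionCouplings P Q)

/-- The entropic optimal transition coupling cost `ρ_η(P, Q)`. -/
noncomputable def rhoEta (c : 𝒳 × 𝒴 → ℝ) (η : ℝ) (P : Matrix 𝒳 𝒳 ℝ) (Q : Matrix 𝒴 𝒴 ℝ) :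
    EReal :=
  optimalValue c (transitionCouplingsEta η P Q)

/-- The entropic optimal solutions `Φ*_η(P, Q)`. -/
def PhiStarEta (c : 𝒳 × 𝒴 → ℝ) (η : ℝ) (P : Matrix 𝒳 𝒳 ℝ) (Q : Matrix 𝒴 𝒴 ℝ) :
    Set ((𝒳 × 𝒴 → ℝ) × Matrix (𝒳 × 𝒴) (𝒳 × 𝒴) ℝ) :=
  optimalSolutions c (transitionCouplingsEta η P Q)

end OptimalTransitionCoupling

/-- Upper limit of a sequence of sets in a topological space. -/
def setLimsup {Z : Type*} [TopologicalSpace Z] (A : ℕ → Set Z) : Set Z :=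
  ⋂ n, closure (⋃ m ≥ n, A m)

section Observations

variable {Ω 𝒳 : Type*}

/-- The left shift on sequences. -/
def shift (u : ℕ → 𝒳) : ℕ → 𝒳 := fun i => u (i + 1)

/-- The process `X` is stationary and ergodic: the left shift preserves the law of
`(X 0, X 1, …)` and is ergodic for it. -/
def StationaryErgodic [MeasurableSpace Ω] [MeasurableSpace 𝒳] (μ : Measure Ω)
    (X : ℕ → Ω → 𝒳) : Prop :=
  Ergodic (shift : (ℕ → 𝒳) → (ℕ → 𝒳)) (μ.map (fun ω i => X i ω))

/-- The one-step transition matrix `μ(X 0 = x, X 1 = x') / μ(X 0 = x)`, with `0 / 0 = 0`. -/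
noncomputable def oneStepMatrix [MeasurableSpace Ω] (μ : Measure Ω) (X : ℕ → Ω → 𝒳) :
    Matrix 𝒳 𝒳 ℝ :=
  fun x x' => μ.real {ω | X 0 ω = x ∧ X 1 ω = x'} / μ.real {ω | X 0 ω = x}

/-- The relative frequencies of transitions in the first `n` observations `u 0, …, u (n - 1)`:
the number of transitions from `x` to `x'` divided by the number of transitions from `x`,
with `0 / 0 = 0`. -/
noncomputable def empiricalMatrix [DecidableEq 𝒳] (u : ℕ → 𝒳) (n : ℕ) : Matrix 𝒳 𝒳 ℝ :=
  fun x x' =>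
    (((Finset.range (n - 1)).filter (fun i => u i = x ∧ u (i + 1) = x')).card : ℝ) /
      (((Finset.range (n - 1)).filter (fun i => u i = x)).card : ℝ)

end Observations

end OTC

/-! The proof separates a probabilistic input from a deterministic stability statement. With
probability one, the empirical matrices converge to the true one, have stochastic rows from some
index on, and charge only transitions of the limit (`StochasticApprox`). Convergence is Birkhoff's
theorem on path space. The support condition is exact, since a pattern of probability zero almost
surely never occurs.

Optimal values and solutions are stable under two conditions: limits of feasible points are
feasible, and each feasible point of the limit program is matched in cost by feasible points of the
approximating ones. The first is continuity. The obstacle lies in the second: a transition coupling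
`R` may have several stationary distributions, so a given `lam` with `lam R = lam` need not be close
to a stationary distribution of a nearby matrix.

It is overcome by perturbing to the interior. Mixing the flow `lam(s) R(s,t)` with a little of the
stationary flow of `P ⊗ Q` makes `lam` positive, gives `R` the full support of `P ⊗ Q`, and makes
the divergence bounds strict. Correcting the marginals of `R` then yields couplings `Rn` of the
empirical rows with support inside that of `R`. For such `Rn`, `exists_tendsto_stationary` produces
stationary distributions converging to `lam`: the density with respect to `lam` of any stationary
vector of `R` is constant along transitions of `R`, hence harmonic for `Rn`, and Cesàro limits under
`Rn` preserve pairings with harmonic functions.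

The bound `τ` ranges over `EReal`, so `τ = ⊤` gives the unconstrained program and `τ = η` the
entropic one. -/

namespace OTC

/-! ### Birkhoff's pointwise ergodic theorem. -/

section Ergodic

variable {α : Type*}

/-- The maximum of `0` and the first `n` Birkhoff sums of `g`. -/
noncomputable def birkhoffMax (T : α → α) (g : α → ℝ) : ℕ → α → ℝ
  | 0 => fun _ => 0
  | n + 1 => fun x => max 0 (g x + birkhoffMax T g n (T x))

lemma birkhoffMax_nonneg (T : α → α) (g : α → ℝ) (n : ℕ) (x : α) : 0 ≤ birkhoffMax T g n x := by
  cases n with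
  | zero => exact le_rfl
  | succ n => exact le_max_left _ _

lemma birkhoffMax_le_succ (T : α → α) (g : α → ℝ) (n : ℕ) (x : α) :
    birkhoffMax T g n x ≤ birkhoffMax T g (n + 1) x := by
  induction n generalizing x with
  | zero => exact birkhoffMax_nonneg T g 1 x
  | succ n ih => exact max_le_max le_rfl (by gcongr; exact ih (T x))

lemma birkhoffMax_mono (T : α → α) (g : α → ℝ) (x : α) :
    Monotone fun n => birkhoffMax T g n x :=
  monotone_nat_of_le_succ fun n => birkhoffMax_le_succ T g n x

lemma birkhoffSum_le_birkhoffMax (T : α → α) (g : α → ℝ) (n : ℕ) (x : α) :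
    birkhoffSum T g n x ≤ birkhoffMax T g n x := by
  induction n generalizing x with
  | zero => simp [birkhoffMax]
  | succ n ih =>
    rw [birkhoffSum_succ']
    exact (add_le_add_right (ih (T x)) _).trans (le_max_right _ _)

/-- The recursion changes the maxima by the finite amount `g x` only, so boundedness is a strictly
invariant event and ergodicity gives it measure zero or one. -/
lemma bddAbove_birkhoffMax_iff (T : α → α) (g : α → ℝ) (x : α) :
    BddAbove (Set.range fun n => birkhoffMax T g n (T x)) ↔
      BddAbove (Set.range fun n => birkhoffMax T g n x) := by
  constructor
  · rintro ⟨C, hC⟩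
    refine ⟨max 0 (g x + C), ?_⟩
    rintro _ ⟨n, rfl⟩
    refine (birkhoffMax_le_succ T g n x).trans ?_
    exact max_le_max le_rfl (by gcongr; exact hC ⟨n, rfl⟩)
  · rintro ⟨C, hC⟩
    refine ⟨C - g x, ?_⟩
    rintro _ ⟨n, rfl⟩
    have h : birkhoffMax T g (n + 1) x ≤ C := hC ⟨n + 1, rfl⟩
    have h' : g x + birkhoffMax T g n (T x) ≤ birkhoffMax T g (n + 1) x := le_max_right _ _
    show birkhoffMax T g n (T x) ≤ C - g x
    linarith

variable [MeasurableSpace α] {μ : Measure α} {T : α → α}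

lemma measurable_birkhoffMax (hT : Measurable T) {g : α → ℝ} (hg : Measurable g) (n : ℕ) :
    Measurable (birkhoffMax T g n) := by
  induction n with
  | zero => exact measurable_const
  | succ n ih => exact measurable_const.max (hg.add (ih.comp hT))

lemma integrable_birkhoffMax [IsFiniteMeasure μ] (hT : MeasurePreserving T μ μ) {g : α → ℝ}
    (hg : Integrable g μ) (n : ℕ) : Integrable (birkhoffMax T g n) μ := by
  induction n with
  | zero => exact integrable_const _
  | succ n ih => exact (integrable_const _).sup (hg.add (hT.integrable_comp_of_integrable ih))

/-- The Birkhoff sums of a function with negative integral are almost surely bounded above. -/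
lemma ae_bddAbove_birkhoffSum [IsProbabilityMeasure μ] (hT : Ergodic T μ) {g : α → ℝ}
    (hgm : Measurable g) (hg : Integrable g μ) (hneg : ∫ x, g x ∂μ < 0) :
    ∀ᵐ x ∂μ, BddAbove (Set.range fun n => birkhoffSum T g n x) := by
  set E : Set α := {x | BddAbove (Set.range fun n => birkhoffMax T g n x)} with hE
  have hTm := hT.toMeasurePreserving
  have hEm : MeasurableSet E :=
    measurableSet_bddAbove_range fun n => measurable_birkhoffMax hTm.measurable hgm n
  have hinv : T ⁻¹' E = E := by
    ext x
    exact bddAbove_birkhoffMax_iff T g x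
  rcases hT.toPreErgodic.ae_mem_or_ae_notMem hEm hinv with h | h
  · filter_upwards [h] with x hx
    obtain ⟨C, hC⟩ := hx
    refine ⟨C, ?_⟩
    rintro _ ⟨n, rfl⟩
    exact (birkhoffSum_le_birkhoffMax T g n x).trans (hC ⟨n, rfl⟩)
  · exfalso
    have hM := integrable_birkhoffMax hTm hg
    have hMT : ∀ n, Integrable (fun x => birkhoffMax T g n (T x)) μ := fun n =>
      hTm.integrable_comp_of_integrable (hM n)
    -- If the maxima are almost surely unbounded, this difference tends to `g`, dominated by `|g|`.
    -- Its integral is nonnegative by invariance and monotonicity, which contradicts `∫ g < 0`.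
    have hdiff : ∀ n x, birkhoffMax T g (n + 1) x - birkhoffMax T g n (T x) =
        max (-birkhoffMax T g n (T x)) (g x) := by
      intro n x
      show max 0 (g x + birkhoffMax T g n (T x)) - _ = _
      rw [max_sub_sub_right 0 _ _ |>.symm]
      simp
    have hnn : ∀ n, 0 ≤ ∫ x, (birkhoffMax T g (n + 1) x - birkhoffMax T g n (T x)) ∂μ := by
      intro n
      rw [integral_sub (hM _) (hMT n)]
      have : ∫ x, birkhoffMax T g n (T x) ∂μ = ∫ x, birkhoffMax T g n x ∂μ := by
        conv_rhs => rw [← hTm.map_eq]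
        rw [integral_map hTm.aemeasurable]
        exact (measurable_birkhoffMax hTm.measurable hgm n).aestronglyMeasurable
      rw [this, sub_nonneg]
      exact integral_mono (hM n) (hM (n + 1)) (birkhoffMax_le_succ T g n)
    have hlim : Tendsto
        (fun n => ∫ x, (birkhoffMax T g (n + 1) x - birkhoffMax T g n (T x)) ∂μ) atTop
        (𝓝 (∫ x, g x ∂μ)) := by
      refine tendsto_integral_of_dominated_convergence (fun x => |g x|)
        (fun n => ((hM _).sub (hMT n)).aestronglyMeasurable) hg.abs ?_ ?_
      · intro n
        filter_upwards with x
        have h0 := birkhoffMax_nonneg T g n (T x)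
        rw [hdiff, Real.norm_eq_abs, abs_le]
        exact ⟨(neg_abs_le _).trans (le_max_right _ _),
          max_le ((neg_nonpos.2 h0).trans (abs_nonneg _)) (le_abs_self _)⟩
      · filter_upwards [h] with x hx
        have hx' : ¬ BddAbove (Set.range fun n => birkhoffMax T g n (T x)) := fun hb =>
          hx ((bddAbove_birkhoffMax_iff T g x).1 hb)
        have ht := (tendsto_atTop_atTop_of_monotone (birkhoffMax_mono T g (T x))
          (fun b => by
            by_contra! hb
            exact hx' ⟨b, by rintro _ ⟨n, rfl⟩; exact (hb n).le⟩))
        refine tendsto_const_nhds.congr' ?_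
        filter_upwards [ht.eventually_ge_atTop (-g x)] with n hn
        rw [hdiff, max_eq_right (by linarith)]
    exact absurd (ge_of_tendsto' hlim hnn) (not_le.2 hneg)

/-- The pointwise ergodic theorem, upper half. -/
lemma ae_eventually_birkhoffSum_le [IsProbabilityMeasure μ] (hT : Ergodic T μ) {f : α → ℝ}
    (hfm : Measurable f) (hf : Integrable f μ) :
    ∀ᵐ x ∂μ, ∀ ε > 0, ∀ᶠ n : ℕ in atTop, birkhoffSum T f n x ≤ n * (∫ y, f y ∂μ + ε) := by
  -- Centering slightly above the mean makes the integral negative. Countably many margins suffice,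
  -- and the leftover linear slack absorbs the bound `C`.
  have key : ∀ k : ℕ, ∀ᵐ x ∂μ, BddAbove
      (Set.range fun n => birkhoffSum T (fun y => f y - (∫ z, f z ∂μ + 1 / (k + 1 : ℝ))) n x) := by
    intro k
    refine ae_bddAbove_birkhoffSum hT (hfm.sub measurable_const) (hf.sub (integrable_const _)) ?_
    rw [integral_sub hf (integrable_const _)]
    have : (0 : ℝ) < 1 / (k + 1) := by positivity
    simp only [integral_const, probReal_univ, smul_eq_mul, one_mul]
    linarith
  filter_upwards [ae_all_iff.2 key] with x hx ε hε
  obtain ⟨k, hk⟩ := exists_nat_one_div_lt hε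
  obtain ⟨C, hC⟩ := hx k
  have hlin : Tendsto (fun n : ℕ => (n : ℝ) * (ε - 1 / (k + 1 : ℝ))) atTop atTop :=
    tendsto_natCast_atTop_atTop.atTop_mul_const (sub_pos.2 hk)
  filter_upwards [hlin.eventually_ge_atTop C] with n hn
  have h : birkhoffSum T (fun y => f y - (∫ z, f z ∂μ + 1 / (k + 1 : ℝ))) n x ≤ C := hC ⟨n, rfl⟩
  simp only [birkhoffSum, Finset.sum_sub_distrib, Finset.sum_const, Finset.card_range,
    nsmul_eq_mul] at h ⊢
  linarith

/-- The pointwise ergodic theorem for an ergodic transformation. -/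
theorem ae_tendsto_birkhoffSum_div [IsProbabilityMeasure μ] (hT : Ergodic T μ) {f : α → ℝ}
    (hfm : Measurable f) (hf : Integrable f μ) :
    ∀ᵐ x ∂μ, Tendsto (fun n : ℕ => birkhoffSum T f n x / n) atTop (𝓝 (∫ y, f y ∂μ)) := by
  filter_upwards [ae_eventually_birkhoffSum_le hT hfm hf,
    ae_eventually_birkhoffSum_le hT hfm.neg hf.neg] with x h1 h2
  refine Metric.tendsto_nhds.2 fun ε hε => ?_
  filter_upwards [h1 (ε / 2) (half_pos hε), h2 (ε / 2) (half_pos hε), eventually_gt_atTop 0]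
    with n a b hn
  have hn' : (0 : ℝ) < n := Nat.cast_pos.2 hn
  rw [birkhoffSum_neg] at b
  simp only [Pi.neg_apply, integral_neg] at b
  rw [mul_comm, ← div_le_iff₀ hn'] at a
  have b' : -(birkhoffSum T f n x / n) ≤ -∫ y, f y ∂μ + ε / 2 := by
    rw [← neg_div, div_le_iff₀ hn', mul_comm]
    exact b
  rw [Real.dist_eq, abs_lt]
  constructor <;> linarith

end Ergodic

end OTC

namespace OTC

/-! ### Stability of values and minimizers in an abstract program. -/

section Program

variable {S : Type*} [Fintype S]

instance firstCountableTopology_matrix : FirstCountableTopology (Matrix S S ℝ) :=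
  inferInstanceAs (FirstCountableTopology (S → S → ℝ))

/-- The pairs of a probability vector and a row-stochastic matrix. -/
def stochasticPairs (S : Type*) [Fintype S] : Set ((S → ℝ) × Matrix S S ℝ) :=
  stdSimplex ℝ S ×ˢ {R | ∀ s, R s ∈ stdSimplex ℝ S}

lemma isCompact_stochasticPairs : IsCompact (stochasticPairs S) := by
  refine (isCompact_stdSimplex ℝ S).prod ?_
  have : {R : Matrix S S ℝ | ∀ s, R s ∈ stdSimplex ℝ S} =
      Set.univ.pi fun _ : S => stdSimplex ℝ S := by
    ext R
    exact Set.mem_univ_pi.symm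
  rw [this]
  exact isCompact_univ_pi fun _ => isCompact_stdSimplex ℝ S

lemma continuous_cost (c : S → ℝ) :
    Continuous fun z : (S → ℝ) × Matrix S S ℝ => c ⬝ᵥ z.1 := by
  unfold dotProduct
  fun_prop

lemma feasible_subset_stochasticPairs {C : Set (Matrix S S ℝ)}
    (hC : ∀ R ∈ C, ∀ s, R s ∈ stdSimplex ℝ S) : feasible C ⊆ stochasticPairs S :=
  fun _ hz => ⟨hz.1, hC _ hz.2.1⟩

/-- Limits along subsequences of feasible points of the constraint sets `Cn n` are feasible
for `C`. -/
def LimitsFeasible (Cn : ℕ → Set (Matrix S S ℝ)) (C : Set (Matrix S S ℝ)) : Prop :=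
  ∀ (φ : ℕ → ℕ) (z : ℕ → (S → ℝ) × Matrix S S ℝ) (w : (S → ℝ) × Matrix S S ℝ),
    Tendsto φ atTop atTop → (∀ j, z j ∈ feasible (Cn (φ j))) → Tendsto z atTop (𝓝 w) →
      w ∈ feasible C

/-- Each feasible point of `C` is matched in cost, up to any `δ > 0`, by feasible points of all
but finitely many `Cn n`. -/
def CostsApproximable (c : S → ℝ) (Cn : ℕ → Set (Matrix S S ℝ)) (C : Set (Matrix S S ℝ)) :
    Prop :=
  ∀ w ∈ feasible C, ∀ δ > 0, ∀ᶠ n in atTop, ∃ z ∈ feasible (Cn n), c ⬝ᵥ z.1 ≤ c ⬝ᵥ w.1 + δ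

variable {c : S → ℝ} {Cn : ℕ → Set (Matrix S S ℝ)} {C : Set (Matrix S S ℝ)}

/-- Compactness of the stochastic pairs and `hlim` give the lower bound, `happ` the upper one.
Infeasible programs, of value `⊤`, need no separate treatment. -/
lemma tendsto_optimalValue (hCn : ∀ n, ∀ R ∈ Cn n, ∀ s, R s ∈ stdSimplex ℝ S)
    (hlim : LimitsFeasible Cn C) (happ : CostsApproximable c Cn C) :
    Tendsto (fun n => optimalValue c (Cn n)) atTop (𝓝 (optimalValue c C)) := by
  refine tendsto_order.2 ⟨fun a ha => ?_, fun b hb => ?_⟩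
  · by_contra hcon
    obtain ⟨a', haa', ha'⟩ := EReal.lt_iff_exists_real_btwn.1 ha
    obtain ⟨φ, hφ, hφa⟩ := extraction_of_frequently_atTop (not_eventually.1 hcon)
    have hex : ∀ j, ∃ z ∈ feasible (Cn (φ j)), c ⬝ᵥ z.1 < a' := by
      intro j
      have h : optimalValue c (Cn (φ j)) < (a' : EReal) := (not_lt.1 (hφa j)).trans_lt haa'
      obtain ⟨z, hz⟩ := iInf_lt_iff.1 h
      obtain ⟨hzf, hz⟩ := iInf_lt_iff.1 hz
      exact ⟨z, hzf, EReal.coe_lt_coe_iff.1 hz⟩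
    choose z hz hza using hex
    obtain ⟨w, -, ψ, hψ, hw⟩ := isCompact_stochasticPairs.tendsto_subseq
      fun j => feasible_subset_stochasticPairs (hCn _) (hz j)
    have hwf : w ∈ feasible C :=
      hlim (φ ∘ ψ) (z ∘ ψ) w (hφ.tendsto_atTop.comp hψ.tendsto_atTop) (fun j => hz _) hw
    have hle : c ⬝ᵥ w.1 ≤ a' :=
      le_of_tendsto' (((continuous_cost c).tendsto w).comp hw) fun j => (hza _).le
    have : optimalValue c C ≤ a' := (iInf₂_le w hwf).trans (EReal.coe_le_coe_iff.2 hle)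
    exact absurd ha' (not_lt.2 this)
  · obtain ⟨w, hw⟩ := iInf_lt_iff.1 hb
    obtain ⟨hwf, hw⟩ := iInf_lt_iff.1 hw
    obtain ⟨b', hwb', hb'⟩ := EReal.lt_iff_exists_real_btwn.1 hw
    filter_upwards [happ w hwf (b' - c ⬝ᵥ w.1) (sub_pos.2 (EReal.coe_lt_coe_iff.1 hwb'))]
      with n hn
    obtain ⟨z, hz, hzw⟩ := hn
    refine ((iInf₂_le z hz).trans (EReal.coe_le_coe_iff.2 ?_)).trans_lt hb'
    linarith

lemma exists_subseq_of_mem_setLimsup {Z : Type*} [TopologicalSpace Z] [FirstCountableTopology Z]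
    {A : ℕ → Set Z} {w : Z} (hw : w ∈ setLimsup A) :
    ∃ (φ : ℕ → ℕ) (z : ℕ → Z), Tendsto φ atTop atTop ∧ (∀ j, z j ∈ A (φ j)) ∧
      Tendsto z atTop (𝓝 w) := by
  obtain ⟨U, hU⟩ := (𝓝 w).exists_antitone_basis
  have hex : ∀ j, ∃ m ≥ j, ∃ z ∈ A m, z ∈ U j := by
    intro j
    have h := Set.mem_iInter.1 hw j
    obtain ⟨z, hzU, hz⟩ := mem_closure_iff_nhds.1 h (U j) (hU.1.mem_of_mem trivial)
    simp only [Set.mem_iUnion, exists_prop] at hz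
    obtain ⟨m, hm, hz⟩ := hz
    exact ⟨m, hm, z, hz, hzU⟩
  choose φ hφ z hz hzU using hex
  exact ⟨φ, z, tendsto_atTop_mono hφ tendsto_id, hz, hU.tendsto hzU⟩

/-- Every competitor of the limit program is nearly matched by competitors of the approximating
ones, which the optimizers beat; the inequality passes to the limit. -/
lemma setLimsup_optimalSolutions_subset (hlim : LimitsFeasible Cn C)
    (happ : CostsApproximable c Cn C) :
    setLimsup (fun n => optimalSolutions c (Cn n)) ⊆ optimalSolutions c C := by
  intro w hw
  obtain ⟨φ, z, hφ, hz, hzw⟩ := exists_subseq_of_mem_setLimsup hw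
  refine ⟨hlim φ z w hφ (fun j => (hz j).1) hzw, fun v hv => ?_⟩
  refine le_of_forall_pos_le_add fun δ hδ => ?_
  refine le_of_tendsto (((continuous_cost c).tendsto w).comp hzw) ?_
  filter_upwards [hφ.eventually (happ v hv δ hδ)] with j hj
  obtain ⟨y, hy, hyv⟩ := hj
  exact ((hz j).2 y hy).trans hyv

end Program

end OTC

namespace OTC

/-! ### Stationary distributions of perturbed stochastic matrices. -/

section Stationary

open Matrix

variable {S : Type*} [Fintype S]

lemma vecMul_mem_stdSimplex {R : Matrix S S ℝ} (hR : ∀ s, R s ∈ stdSimplex ℝ S) {v : S → ℝ}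
    (hv : v ∈ stdSimplex ℝ S) : v ᵥ* R ∈ stdSimplex ℝ S := by
  rw [vecMul_eq_sum]
  exact (convex_stdSimplex ℝ S).sum_mem (fun i _ => hv.1 i) hv.2 fun i _ => hR i

/-- A stochastic matrix has a stationary distribution which agrees with a given distribution on
all harmonic functions. -/
lemma exists_stationary_eq_on_harmonic {R : Matrix S S ℝ} (hR : ∀ s, R s ∈ stdSimplex ℝ S)
    {lam : S → ℝ} (hlam : lam ∈ stdSimplex ℝ S) :
    ∃ ν ∈ stdSimplex ℝ S, ν ᵥ* R = ν ∧ ∀ h : S → ℝ, R *ᵥ h = h → ν ⬝ᵥ h = lam ⬝ᵥ h := by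
  set L : ℕ → S → ℝ := fun i => (fun v => v ᵥ* R)^[i] lam with hL
  have hLsucc : ∀ i, L (i + 1) = L i ᵥ* R := fun i => Function.iterate_succ_apply' _ _ _
  have hLmem : ∀ i, L i ∈ stdSimplex ℝ S := by
    intro i
    induction i with
    | zero => exact hlam
    | succ i ih => rw [hLsucc]; exact vecMul_mem_stdSimplex hR ih
  have hLharm : ∀ h : S → ℝ, R *ᵥ h = h → ∀ i, L i ⬝ᵥ h = lam ⬝ᵥ h := by
    intro h hh i
    induction i with
    | zero => rfl
    | succ i ih => rw [hLsucc, ← dotProduct_mulVec, hh, ih]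
  set a : ℕ → S → ℝ := fun k => ∑ i ∈ Finset.range (k + 1), ((k : ℝ) + 1)⁻¹ • L i with ha
  have hk : ∀ k : ℕ, (0 : ℝ) < (k : ℝ) + 1 := fun k => by positivity
  have hw : ∀ k : ℕ, ∑ _i ∈ Finset.range (k + 1), ((k : ℝ) + 1)⁻¹ = 1 := by
    intro k
    simp [(hk k).ne']
  have hamem : ∀ k, a k ∈ stdSimplex ℝ S := fun k =>
    (convex_stdSimplex ℝ S).sum_mem (fun _ _ => (inv_pos.2 (hk k)).le) (hw k)
      fun i _ => hLmem i
  have haharm : ∀ h : S → ℝ, R *ᵥ h = h → ∀ k, a k ⬝ᵥ h = lam ⬝ᵥ h := by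
    intro h hh k
    simp only [ha, sum_dotProduct, smul_dotProduct, hLharm h hh, ← Finset.sum_smul, hw k,
      one_smul]
  have hadiff : ∀ k, a k ᵥ* R - a k = ((k : ℝ) + 1)⁻¹ • (L (k + 1) - L 0) := by
    intro k
    simp only [ha, sum_vecMul, smul_vecMul, ← hLsucc]
    rw [← Finset.smul_sum, ← Finset.smul_sum, ← smul_sub, ← Finset.sum_sub_distrib,
      Finset.sum_range_sub]
  obtain ⟨ν, hν, ψ, hψ, hlim⟩ := (isCompact_stdSimplex ℝ S).tendsto_subseq hamem
  refine ⟨ν, hν, ?_, ?_⟩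
  · have hcont : Continuous fun v : S → ℝ => v ᵥ* R := by
      simp only [vecMul_eq_sum]
      fun_prop
    have h1 : Tendsto (fun j => a (ψ j) ᵥ* R - a (ψ j)) atTop (𝓝 (ν ᵥ* R - ν)) :=
      ((hcont.tendsto ν).comp hlim).sub hlim
    have h2 : Tendsto (fun j => a (ψ j) ᵥ* R - a (ψ j)) atTop (𝓝 0) := by
      refine tendsto_pi_nhds.2 fun s => ?_
      have h3 : Tendsto (fun j => ((ψ j : ℝ) + 1)⁻¹) atTop (𝓝 0) := by
        have := (tendsto_one_div_add_atTop_nhds_zero_nat (𝕜 := ℝ)).comp hψ.tendsto_atTop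
        simpa [Function.comp_def] using this
      refine squeeze_zero_norm (fun j => ?_) h3
      have hcoord : ∀ i, 0 ≤ L i s ∧ L i s ≤ 1 := fun i =>
        ⟨(hLmem i).1 s, (mem_Icc_of_mem_stdSimplex (hLmem i) s).2⟩
      rw [hadiff, Pi.smul_apply, smul_eq_mul, norm_mul, Real.norm_eq_abs, Real.norm_eq_abs,
        abs_of_pos (inv_pos.2 (hk _))]
      refine mul_le_of_le_one_right (inv_pos.2 (hk _)).le ?_
      rw [Pi.sub_apply, abs_le]
      constructor <;> linarith [(hcoord (ψ j + 1)).1, (hcoord (ψ j + 1)).2, (hcoord 0).1,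
        (hcoord 0).2]
    exact sub_eq_zero.1 (tendsto_nhds_unique h1 h2)
  · intro h hh
    have hcont : Continuous fun v : S → ℝ => v ⬝ᵥ h := by
      unfold dotProduct
      fun_prop
    refine tendsto_nhds_unique ((hcont.tendsto ν).comp hlim) ?_
    simp only [Function.comp_def, haharm h hh]
    exact tendsto_const_nhds

/-- The density of a stationary vector with respect to a positive one is constant along the
transitions of positive probability. -/
lemma density_eq_of_ne_zero {R : Matrix S S ℝ} (hR : ∀ s, R s ∈ stdSimplex ℝ S)
    {lam ν : S → ℝ} (hpos : ∀ s, 0 < lam s) (hlam : lam ᵥ* R = lam) (hν : ν ᵥ* R = ν)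
    {s t : S} (hst : R s t ≠ 0) : ν s / lam s = ν t / lam t := by
  set g : S → ℝ := fun s => ν s / lam s with hg
  have hgν : ∀ s, lam s * g s = ν s := fun s => mul_div_cancel₀ _ (hpos s).ne'
  have hcol : ∀ t, ∑ s, lam s * R s t = lam t := fun t => congrFun hlam t
  have hcolν : ∀ t, ∑ s, ν s * R s t = ν t := fun t => congrFun hν t
  -- The Dirichlet energy of the density vanishes: by stationarity of `lam` and `ν`, the two squares
  -- and the cross term all reduce to `∑ lam g²`.
  have hzero : ∑ s, ∑ t, lam s * R s t * (g s - g t) ^ 2 = 0 := by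
    have e1 : ∑ s, ∑ t, lam s * R s t * g s ^ 2 = ∑ s, lam s * g s ^ 2 := by
      refine Finset.sum_congr rfl fun s _ => ?_
      rw [← Finset.sum_mul, ← Finset.mul_sum, (hR s).2, mul_one]
    have e2 : ∑ s, ∑ t, lam s * R s t * g t ^ 2 = ∑ s, lam s * g s ^ 2 := by
      rw [Finset.sum_comm]
      refine Finset.sum_congr rfl fun t _ => ?_
      rw [← Finset.sum_mul, hcol]
    have e3 : ∑ s, ∑ t, ν s * R s t * g t = ∑ s, lam s * g s ^ 2 := by
      rw [Finset.sum_comm]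
      refine Finset.sum_congr rfl fun t _ => ?_
      rw [← Finset.sum_mul, hcolν, ← hgν t]
      ring
    have e4 : ∀ s t, lam s * R s t * (g s - g t) ^ 2 = lam s * R s t * g s ^ 2 +
        lam s * R s t * g t ^ 2 - 2 * (ν s * R s t * g t) := by
      intro s t
      rw [← hgν s]
      ring
    simp only [e4, Finset.sum_sub_distrib, Finset.sum_add_distrib, ← Finset.mul_sum, e1, e2, e3]
    ring
  have hnn : ∀ s t, 0 ≤ lam s * R s t * (g s - g t) ^ 2 := fun s t =>
    mul_nonneg (mul_nonneg (hpos s).le ((hR s).1 t)) (sq_nonneg _)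
  have h1 := (Finset.sum_eq_zero_iff_of_nonneg
    fun s _ => Finset.sum_nonneg fun t _ => hnn s t).1 hzero s (Finset.mem_univ s)
  have h2 := (Finset.sum_eq_zero_iff_of_nonneg fun t _ => hnn s t).1 h1 t (Finset.mem_univ t)
  have h3 : (g s - g t) ^ 2 = 0 :=
    (mul_eq_zero.1 h2).resolve_left (mul_ne_zero (hpos s).ne' hst)
  exact sub_eq_zero.1 (pow_eq_zero_iff two_ne_zero |>.1 h3)

/-- A positive stationary distribution of `R` is a limit of stationary distributions of any
stochastic matrices that converge to `R` and charge no transitions which `R` does not. -/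
lemma exists_tendsto_stationary {Rn : ℕ → Matrix S S ℝ} {R : Matrix S S ℝ} {lam : S → ℝ}
    (hlim : Tendsto Rn atTop (𝓝 R))
    (hRn : ∀ᶠ n in atTop, (∀ s, Rn n s ∈ stdSimplex ℝ S) ∧ ∀ s t, R s t = 0 → Rn n s t = 0)
    (hR : ∀ s, R s ∈ stdSimplex ℝ S) (hmem : lam ∈ stdSimplex ℝ S) (hpos : ∀ s, 0 < lam s)
    (hlam : lam ᵥ* R = lam) :
    ∃ ν : ℕ → S → ℝ, Tendsto ν atTop (𝓝 lam) ∧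
      ∀ᶠ n in atTop, ν n ∈ stdSimplex ℝ S ∧ ν n ᵥ* Rn n = ν n := by
  have hex : ∀ n, ∃ ν ∈ stdSimplex ℝ S, (∀ s, Rn n s ∈ stdSimplex ℝ S) →
      ν ᵥ* Rn n = ν ∧ ∀ h : S → ℝ, Rn n *ᵥ h = h → ν ⬝ᵥ h = lam ⬝ᵥ h := by
    intro n
    by_cases hn : ∀ s, Rn n s ∈ stdSimplex ℝ S
    · obtain ⟨ν, hν, h⟩ := exists_stationary_eq_on_harmonic hn hmem
      exact ⟨ν, hν, fun _ => h⟩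
    · exact ⟨lam, hmem, fun h => absurd h hn⟩
  choose ν hν hνR using hex
  refine ⟨ν, ?_, hRn.mono fun n hn => ⟨hν n, (hνR n hn.1).1⟩⟩
  refine tendsto_of_subseq_tendsto fun φ hφ => ?_
  obtain ⟨m, hm, ψ, hψ, hmlim⟩ := (isCompact_stdSimplex ℝ S).tendsto_subseq fun j => hν (φ j)
  refine ⟨ψ, ?_⟩
  have hφψ : Tendsto (φ ∘ ψ) atTop atTop := hφ.comp hψ.tendsto_atTop
  have hgood := hφψ.eventually hRn
  have hmR : m ᵥ* R = m := by
    have hcont : Continuous fun p : (S → ℝ) × Matrix S S ℝ => p.1 ᵥ* p.2 :=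
      continuous_fst.matrix_vecMul continuous_snd
    have h1 := (hcont.tendsto (m, R)).comp (hmlim.prodMk_nhds (hlim.comp hφψ))
    refine tendsto_nhds_unique h1 (hmlim.congr' ?_)
    filter_upwards [hgood] with j hj
    exact ((hνR _ hj.1).1).symm
  -- The density of the limit `m` is harmonic for `Rn` itself, so it can be tested against `ν`. This
  -- gives `∑ m g = ∑ lam g = 1`, so `g` has mean and second moment `1` under `lam`, hence variance
  -- zero, and `m = lam`.
  set g : S → ℝ := fun s => m s / lam s with hg
  have hgm : ∀ s, lam s * g s = m s := fun s => mul_div_cancel₀ _ (hpos s).ne'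
  have hmg : m ⬝ᵥ g = lam ⬝ᵥ g := by
    have hcont : Continuous fun v : S → ℝ => v ⬝ᵥ g := by
      unfold dotProduct
      fun_prop
    refine tendsto_nhds_unique ((hcont.tendsto m).comp hmlim) (tendsto_const_nhds.congr' ?_)
    filter_upwards [hgood] with j hj
    refine ((hνR _ hj.1).2 g ?_).symm
    ext s
    have h2 : ∀ t, Rn (φ (ψ j)) s t * g t = Rn (φ (ψ j)) s t * g s := by
      intro t
      by_cases hst : R s t = 0
      · rw [show Rn (φ (ψ j)) s t = 0 from hj.2 s t hst, zero_mul, zero_mul]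
      · rw [show g s = g t from density_eq_of_ne_zero hR hpos hlam hmR hst]
    show ∑ t, Rn (φ (ψ j)) s t * g t = g s
    rw [Finset.sum_congr rfl fun t _ => h2 t, ← Finset.sum_mul]
    have := (hj.1 s).2
    simp only [Function.comp_apply] at this
    rw [this, one_mul]
  have hvar : ∑ s, lam s * (g s - 1) ^ 2 = 0 := by
    have e : ∀ s, lam s * (g s - 1) ^ 2 = m s * g s - 2 * m s + lam s := by
      intro s
      rw [← hgm s]
      ring
    have e1 : ∑ s, m s * g s = 1 := by
      have : ∑ s, lam s * g s = 1 := by simp only [hgm, hm.2]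
      rw [← this]
      exact hmg
    simp only [e, Finset.sum_add_distrib, Finset.sum_sub_distrib, ← Finset.mul_sum, e1, hm.2,
      hmem.2]
    norm_num
  have hmlam : m = lam := by
    ext s
    have h1 := (Finset.sum_eq_zero_iff_of_nonneg
      fun s _ => mul_nonneg (hpos s).le (sq_nonneg (g s - 1))).1 hvar s (Finset.mem_univ s)
    have h2 := pow_eq_zero_iff two_ne_zero |>.1 ((mul_eq_zero.1 h1).resolve_left (hpos s).ne')
    rw [← hgm s, sub_eq_zero.1 h2, mul_one]
  rw [← hmlam]
  exact hmlim

end Stationary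

end OTC

namespace OTC

/-! ### Continuity and convexity of the divergence. -/

section Divergence

variable {S : Type*} [Fintype S]

/-- The real-valued sum that defines the divergence of `u` from `v` if `u` vanishes where `v`
does. -/
noncomputable def klSum (u v : S → ℝ) : ℝ := ∑ s, u s * Real.log (u s / v s)

lemma klVec_eq_klSum {u v : S → ℝ} (h : ∀ s, v s = 0 → u s = 0) :
    klVec u v = (klSum u v : EReal) := if_pos h

lemma mul_log_div_eq {a b : ℝ} (hb : b ≠ 0) :
    a * Real.log (a / b) = b * (a / b * Real.log (a / b)) := by
  rw [← mul_assoc, mul_div_cancel₀ _ hb]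

/-- Where `v` vanishes the quotient is uncontrolled, but there the terms are eventually zero;
elsewhere `t log t` is continuous, also at `0`. -/
lemma tendsto_klSum {ι : Type*} {l : Filter ι} {u v : S → ℝ} {un vn : ι → S → ℝ} [l.NeBot]
    (hu : Tendsto un l (𝓝 u)) (hv : Tendsto vn l (𝓝 v))
    (hsupp : ∀ᶠ i in l, ∀ s, v s = 0 → un i s = 0) :
    Tendsto (fun i => klSum (un i) (vn i)) l (𝓝 (klSum u v)) := by
  refine tendsto_finsetSum _ fun s _ => ?_
  have hus := tendsto_pi_nhds.1 hu s
  have hvs := tendsto_pi_nhds.1 hv s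
  by_cases h : v s = 0
  · have hz : ∀ᶠ i in l, un i s = 0 := hsupp.mono fun i hi => hi s h
    have hu0 : u s = 0 :=
      tendsto_nhds_unique hus (tendsto_const_nhds.congr' (hz.mono fun i hi => hi.symm))
    rw [hu0, zero_mul]
    refine tendsto_const_nhds.congr' (hz.mono fun i hi => ?_)
    simp only [hi, zero_mul]
  · rw [mul_log_div_eq h]
    have hne : ∀ᶠ i in l, vn i s ≠ 0 := hvs.eventually_ne h
    have := hvs.mul ((Real.continuous_mul_log.tendsto _).comp (hus.div hvs h))
    refine this.congr' (hne.mono fun i hi => ?_)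
    exact (mul_log_div_eq hi).symm

/-- Mixing `u` with `v` in the proportion `(1 - θ) : θ` multiplies the divergence from `v` by at
most `1 - θ`. -/
lemma klSum_mix_le {u v : S → ℝ} (hu : ∀ s, 0 ≤ u s) (hv : ∀ s, 0 ≤ v s)
    (huv : ∀ s, v s = 0 → u s = 0) {θ : ℝ} (h0 : 0 ≤ θ) (h1 : θ ≤ 1) :
    klSum (fun s => (1 - θ) * u s + θ * v s) v ≤ (1 - θ) * klSum u v := by
  rw [klSum, klSum, Finset.mul_sum]
  refine Finset.sum_le_sum fun s _ => ?_
  by_cases h : v s = 0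
  · simp [h, huv s h]
  · have hconv := Real.convexOn_mul_log.2 (x := u s / v s) (y := 1)
      (div_nonneg (hu s) (hv s)) (Set.mem_Ici.2 zero_le_one) (sub_nonneg.2 h1) h0 (by ring)
    simp only [smul_eq_mul, Real.log_one, mul_zero, add_zero, mul_one] at hconv
    have e : ((1 - θ) * u s + θ * v s) / v s = (1 - θ) * (u s / v s) + θ := by
      field_simp
    rw [mul_log_div_eq h, mul_log_div_eq h, e, mul_left_comm (1 - θ)]
    exact mul_le_mul_of_nonneg_left hconv (hv s)

lemma coe_mul_lt_of_coe_le {a b : ℝ} {τ : EReal} (hτ : 0 < τ) (ha : (a : EReal) ≤ τ)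
    (hb0 : 0 ≤ b) (hb1 : b < 1) : ((b * a : ℝ) : EReal) < τ := by
  induction τ with
  | bot => simp at hτ
  | top => exact EReal.coe_lt_top _
  | coe t =>
    have ht : 0 < t := EReal.coe_pos.1 hτ
    have hat : a ≤ t := EReal.coe_le_coe_iff.1 ha
    refine EReal.coe_lt_coe_iff.2 ?_
    nlinarith

end Divergence

/-! ### Couplings and the correction of their marginals. -/

section Coupling

variable {𝒳 𝒴 : Type*} [Fintype 𝒳] [Fintype 𝒴]

lemma couplings_eq_zero {u : 𝒳 → ℝ} {v : 𝒴 → ℝ} {r : 𝒳 × 𝒴 → ℝ} (hr : r ∈ couplings u v)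
    {x : 𝒳} {y : 𝒴} (h : u x * v y = 0) : r (x, y) = 0 := by
  refine le_antisymm ?_ (hr.1.1 _)
  rcases mul_eq_zero.1 h with h | h
  · rw [← h, ← hr.2.1 x]
    exact Finset.single_le_sum (f := fun y => r (x, y)) (fun y _ => hr.1.1 _) (Finset.mem_univ y)
  · rw [← h, ← hr.2.2 y]
    exact Finset.single_le_sum (f := fun x => r (x, y)) (fun x _ => hr.1.1 _) (Finset.mem_univ x)

lemma product_mem_couplings {u : 𝒳 → ℝ} {v : 𝒴 → ℝ} (hu : u ∈ stdSimplex ℝ 𝒳)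
    (hv : v ∈ stdSimplex ℝ 𝒴) : (fun p : 𝒳 × 𝒴 => u p.1 * v p.2) ∈ couplings u v := by
  have h1 : ∀ x, ∑ y, u x * v y = u x := fun x => by rw [← Finset.mul_sum, hv.2, mul_one]
  have h2 : ∀ y, ∑ x, u x * v y = v y := fun y => by rw [← Finset.sum_mul, hu.2, one_mul]
  refine ⟨⟨fun p => mul_nonneg (hu.1 _) (hv.1 _), ?_⟩, h1, h2⟩
  rw [Fintype.sum_prod_type]
  simp only [h1, hu.2]

lemma couplings_mix_mem {u : 𝒳 → ℝ} {v : 𝒴 → ℝ} {r r' : 𝒳 × 𝒴 → ℝ} (hr : r ∈ couplings u v)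
    (hr' : r' ∈ couplings u v) {θ : ℝ} (h0 : 0 ≤ θ) (h1 : θ ≤ 1) :
    (fun p => (1 - θ) * r p + θ * r' p) ∈ couplings u v := by
  refine ⟨convex_stdSimplex ℝ _ hr.1 hr'.1 (sub_nonneg.2 h1) h0 (by ring), fun x => ?_,
    fun y => ?_⟩
  · rw [Finset.sum_add_distrib, ← Finset.mul_sum, ← Finset.mul_sum, hr.2.1, hr'.2.1]
    ring
  · rw [Finset.sum_add_distrib, ← Finset.mul_sum, ← Finset.mul_sum, hr.2.2, hr'.2.2]
    ring

lemma mem_couplings_of_tendsto {ι : Type*} {l : Filter ι} [l.NeBot] {u : 𝒳 → ℝ} {v : 𝒴 → ℝ}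
    {r : 𝒳 × 𝒴 → ℝ} {un : ι → 𝒳 → ℝ} {vn : ι → 𝒴 → ℝ} {rn : ι → 𝒳 × 𝒴 → ℝ}
    (hu : Tendsto un l (𝓝 u)) (hv : Tendsto vn l (𝓝 v)) (hr : Tendsto rn l (𝓝 r))
    (h : ∀ i, rn i ∈ couplings (un i) (vn i)) : r ∈ couplings u v := by
  have hr' := tendsto_pi_nhds.1 hr
  refine ⟨(isClosed_stdSimplex ℝ _).mem_of_tendsto hr (Eventually.of_forall fun i => (h i).1),
    fun x => ?_, fun y => ?_⟩
  · refine tendsto_nhds_unique (tendsto_finsetSum _ fun y _ => hr' (x, y)) ?_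
    exact (tendsto_pi_nhds.1 hu x).congr fun i => ((h i).2.1 x).symm
  · refine tendsto_nhds_unique (tendsto_finsetSum _ fun x _ => hr' (x, y)) ?_
    exact (tendsto_pi_nhds.1 hv y).congr fun i => ((h i).2.2 y).symm

/-- The correction of a coupling `r` of `u` and `v` to the marginals `u'` and `v'`. -/
def adjustMarginals (u u' : 𝒳 → ℝ) (v v' : 𝒴 → ℝ) (r : 𝒳 × 𝒴 → ℝ) : 𝒳 × 𝒴 → ℝ :=
  fun p => r p + (u' p.1 - u p.1) * v p.2 + u p.1 * (v' p.2 - v p.2)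

omit [Fintype 𝒳] [Fintype 𝒴] in
lemma tendsto_adjustMarginals {ι : Type*} {l : Filter ι} {u : 𝒳 → ℝ} {v : 𝒴 → ℝ}
    (r : 𝒳 × 𝒴 → ℝ) {un : ι → 𝒳 → ℝ} {vn : ι → 𝒴 → ℝ}
    (hu : Tendsto un l (𝓝 u)) (hv : Tendsto vn l (𝓝 v)) :
    Tendsto (fun i => adjustMarginals u (un i) v (vn i) r) l (𝓝 r) := by
  refine tendsto_pi_nhds.2 fun p => ?_
  have h1 := ((tendsto_pi_nhds.1 hu p.1).sub_const (u p.1)).mul_const (v p.2)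
  have h2 := ((tendsto_pi_nhds.1 hv p.2).sub_const (v p.2)).const_mul (u p.1)
  have h3 := (h1.const_add (r p)).add h2
  simp only [sub_self, zero_mul, mul_zero, add_zero] at h3
  exact h3

/-- The corrections have the right marginals because differences of probability vectors have total
mass zero. Positive entries survive small changes, and entries outside the support of `u ⊗ v` stay
zero. -/
lemma eventually_adjustMarginals_mem {ι : Type*} {l : Filter ι} {u : 𝒳 → ℝ} {v : 𝒴 → ℝ}
    {r : 𝒳 × 𝒴 → ℝ} {un : ι → 𝒳 → ℝ} {vn : ι → 𝒴 → ℝ}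
    (hu : Tendsto un l (𝓝 u)) (hv : Tendsto vn l (𝓝 v))
    (hun : ∀ᶠ i in l, un i ∈ stdSimplex ℝ 𝒳 ∧ ∀ x, u x = 0 → un i x = 0)
    (hvn : ∀ᶠ i in l, vn i ∈ stdSimplex ℝ 𝒴 ∧ ∀ y, v y = 0 → vn i y = 0)
    (hus : u ∈ stdSimplex ℝ 𝒳) (hvs : v ∈ stdSimplex ℝ 𝒴)
    (hr : r ∈ couplings u v) (hpos : ∀ x y, u x * v y ≠ 0 → 0 < r (x, y)) :
    ∀ᶠ i in l, adjustMarginals u (un i) v (vn i) r ∈ couplings (un i) (vn i) := by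
  have hlim := tendsto_pi_nhds.1 (tendsto_adjustMarginals r hu hv)
  have hnn : ∀ᶠ i in l, ∀ p, 0 ≤ adjustMarginals u (un i) v (vn i) r p := by
    refine eventually_all.2 fun p => ?_
    by_cases h : u p.1 * v p.2 = 0
    · filter_upwards [hun, hvn] with i hi hi'
      have hrp : r p = 0 := couplings_eq_zero hr h
      rcases mul_eq_zero.1 h with h | h
      · simp [adjustMarginals, hrp, h, hi.2 _ h]
      · simp [adjustMarginals, hrp, h, hi'.2 _ h]
    · filter_upwards [(hlim p).eventually_const_lt (hpos _ _ h)] with i hi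
      exact hi.le
  filter_upwards [hnn, hun, hvn] with i h0 hi hi'
  have h1 : ∀ x, ∑ y, adjustMarginals u (un i) v (vn i) r (x, y) = un i x := by
    intro x
    simp only [adjustMarginals, Finset.sum_add_distrib, ← Finset.mul_sum, Finset.sum_sub_distrib,
      hr.2.1, hvs.2, hi'.1.2]
    ring
  refine ⟨⟨h0, ?_⟩, h1, fun y => ?_⟩
  · rw [Fintype.sum_prod_type]
    simp only [h1, hi.1.2]
  · simp only [adjustMarginals, Finset.sum_add_distrib, ← Finset.sum_mul, Finset.sum_sub_distrib,
      hr.2.2, hus.2, hi.1.2]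
    ring

end Coupling

/-! ### Stability of the transition coupling programs. -/

section Stability

open Matrix

variable {𝒳 𝒴 : Type*} [Fintype 𝒳] [Fintype 𝒴]

/-- The transition couplings with rows within divergence `τ`, possibly infinite, of the
independent ones. -/
def klTransitionCouplings (τ : EReal) (P : Matrix 𝒳 𝒳 ℝ) (Q : Matrix 𝒴 𝒴 ℝ) :
    Set (Matrix (𝒳 × 𝒴) (𝒳 × 𝒴) ℝ) :=
  {R | R ∈ transitionCouplings P Q ∧ ∀ s, klVec (R s) (indep P Q s) ≤ τ}

lemma klTransitionCouplings_top (P : Matrix 𝒳 𝒳 ℝ) (Q : Matrix 𝒴 𝒴 ℝ) :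
    klTransitionCouplings ⊤ P Q = transitionCouplings P Q := by
  simp [klTransitionCouplings]

lemma klVec_row_eq {P : Matrix 𝒳 𝒳 ℝ} {Q : Matrix 𝒴 𝒴 ℝ} {R : Matrix (𝒳 × 𝒴) (𝒳 × 𝒴) ℝ}
    (hR : R ∈ transitionCouplings P Q) (s : 𝒳 × 𝒴) :
    klVec (R s) (indep P Q s) = (klSum (R s) (indep P Q s) : EReal) :=
  klVec_eq_klSum fun _ ht => couplings_eq_zero (hR s) ht

/-- Stochastic matrices `Pn n` that converge to `P` and eventually charge only the transitions of
`P`, where `P` has a positive stationary distribution. -/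
structure StochasticApprox (Pn : ℕ → Matrix 𝒳 𝒳 ℝ) (P : Matrix 𝒳 𝒳 ℝ) : Prop where
  tendsto : Tendsto Pn atTop (𝓝 P)
  eventually_stochastic : ∀ᶠ n in atTop, ∀ x, Pn n x ∈ stdSimplex ℝ 𝒳
  eventually_support : ∀ᶠ n in atTop, ∀ x x', P x x' = 0 → Pn n x x' = 0
  exists_stationary : ∃ m ∈ stdSimplex ℝ 𝒳, (∀ x, 0 < m x) ∧ m ᵥ* P = m

lemma StochasticApprox.tendsto_row {Pn : ℕ → Matrix 𝒳 𝒳 ℝ} {P : Matrix 𝒳 𝒳 ℝ}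
    (h : StochasticApprox Pn P) (x : 𝒳) : Tendsto (fun n => Pn n x) atTop (𝓝 (P x)) :=
  tendsto_pi_nhds.1 h.tendsto x

lemma StochasticApprox.stochastic {Pn : ℕ → Matrix 𝒳 𝒳 ℝ} {P : Matrix 𝒳 𝒳 ℝ}
    (h : StochasticApprox Pn P) (x : 𝒳) : P x ∈ stdSimplex ℝ 𝒳 :=
  (isClosed_stdSimplex ℝ _).mem_of_tendsto (h.tendsto_row x)
    (h.eventually_stochastic.mono fun _ hn => hn x)

variable {Pn : ℕ → Matrix 𝒳 𝒳 ℝ} {P : Matrix 𝒳 𝒳 ℝ} {Qn : ℕ → Matrix 𝒴 𝒴 ℝ}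
  {Q : Matrix 𝒴 𝒴 ℝ}

omit [Fintype 𝒳] [Fintype 𝒴] in
lemma tendsto_indep (hP : Tendsto Pn atTop (𝓝 P)) (hQ : Tendsto Qn atTop (𝓝 Q)) (s : 𝒳 × 𝒴) :
    Tendsto (fun n => indep (Pn n) (Qn n) s) atTop (𝓝 (indep P Q s)) :=
  tendsto_pi_nhds.2 fun t => (tendsto_pi_nhds.1 (tendsto_pi_nhds.1 hP s.1) t.1).mul
    (tendsto_pi_nhds.1 (tendsto_pi_nhds.1 hQ s.2) t.2)

lemma eventually_transitionCouplings_support (hP : StochasticApprox Pn P)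
    (hQ : StochasticApprox Qn Q) : ∀ᶠ n in atTop, ∀ R ∈ transitionCouplings (Pn n) (Qn n),
      ∀ s t, indep P Q s t = 0 → R s t = 0 := by
  filter_upwards [hP.eventually_support, hQ.eventually_support] with n h1 h2 R hR s t hst
  refine couplings_eq_zero (hR s) ?_
  rcases mul_eq_zero.1 hst with h | h
  · rw [h1 _ _ h, zero_mul]
  · rw [h2 _ _ h, mul_zero]

lemma limitsFeasible_klTransitionCouplings (τ : EReal) (hP : StochasticApprox Pn P)
    (hQ : StochasticApprox Qn Q) :
    LimitsFeasible (fun n => klTransitionCouplings τ (Pn n) (Qn n))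
      (klTransitionCouplings τ P Q) := by
  intro φ z w hφ hz hzw
  have h1 : Tendsto (fun j => (z j).1) atTop (𝓝 w.1) := (continuous_fst.tendsto w).comp hzw
  have h2 : Tendsto (fun j => (z j).2) atTop (𝓝 w.2) := (continuous_snd.tendsto w).comp hzw
  have h2s := tendsto_pi_nhds.1 h2
  have hR : w.2 ∈ transitionCouplings P Q := fun s =>
    mem_couplings_of_tendsto ((hP.tendsto_row s.1).comp hφ) ((hQ.tendsto_row s.2).comp hφ)
      (h2s s) fun j => (hz j).2.1.1 s
  refine ⟨(isClosed_stdSimplex ℝ _).mem_of_tendsto h1 (Eventually.of_forall fun j => (hz j).1),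
    ⟨hR, fun s => ?_⟩, ?_⟩
  · rw [klVec_row_eq hR]
    have hkl := tendsto_klSum (h2s s) ((tendsto_indep hP.tendsto hQ.tendsto s).comp hφ)
      ((hφ.eventually (eventually_transitionCouplings_support hP hQ)).mono
        fun j hj t ht => hj _ (hz j).2.1.1 s t ht)
    refine le_of_tendsto' ((continuous_coe_real_ereal.tendsto _).comp hkl) fun j => ?_
    have := (hz j).2.1.2 s
    rw [klVec_row_eq (hz j).2.1.1] at this
    exact this
  · have hcont : Continuous fun p : (𝒳 × 𝒴 → ℝ) × Matrix (𝒳 × 𝒴) (𝒳 × 𝒴) ℝ => p.1 ᵥ* p.2 :=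
      continuous_fst.matrix_vecMul continuous_snd
    exact tendsto_nhds_unique ((hcont.tendsto w).comp hzw) (h1.congr fun j => (hz j).2.2.symm)

lemma product_vecMul_indep {m : 𝒳 → ℝ} {k : 𝒴 → ℝ} (hm : m ᵥ* P = m) (hk : k ᵥ* Q = k) :
    (fun s : 𝒳 × 𝒴 => m s.1 * k s.2) ᵥ* indep P Q = fun s => m s.1 * k s.2 := by
  ext t
  have h1 : ∑ x, m x * P x t.1 = m t.1 := congrFun hm t.1
  have h2 : ∑ y, k y * Q y t.2 = k t.2 := congrFun hk t.2
  show ∑ s : 𝒳 × 𝒴, m s.1 * k s.2 * (P s.1 t.1 * Q s.2 t.2) = m t.1 * k t.2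
  rw [← h1, ← h2, Finset.sum_mul_sum, Fintype.sum_prod_type]
  exact Finset.sum_congr rfl fun x _ => Finset.sum_congr rfl fun y _ => by ring

/-- A feasible pair can be replaced, at small extra cost, by one with a positive stationary
distribution, all transitions of the independent coupling, and strict divergence bounds. -/
lemma exists_interior_feasible (c : 𝒳 × 𝒴 → ℝ) {τ : EReal} (hτ : 0 < τ)
    (hP : ∀ x, P x ∈ stdSimplex ℝ 𝒳) (hQ : ∀ y, Q y ∈ stdSimplex ℝ 𝒴)
    {m : 𝒳 → ℝ} {k : 𝒴 → ℝ} (hm : m ∈ stdSimplex ℝ 𝒳) (hk : k ∈ stdSimplex ℝ 𝒴)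
    (hm0 : ∀ x, 0 < m x) (hk0 : ∀ y, 0 < k y) (hmP : m ᵥ* P = m) (hkQ : k ᵥ* Q = k)
    {w : (𝒳 × 𝒴 → ℝ) × Matrix (𝒳 × 𝒴) (𝒳 × 𝒴) ℝ}
    (hw : w ∈ feasible (klTransitionCouplings τ P Q)) {δ : ℝ} (hδ : 0 < δ) :
    ∃ z ∈ feasible (transitionCouplings P Q), (∀ s, 0 < z.1 s) ∧
      (∀ s, (klSum (z.2 s) (indep P Q s) : EReal) < τ) ∧
      (∀ s t, indep P Q s t ≠ 0 → 0 < z.2 s t) ∧ c ⬝ᵥ z.1 ≤ c ⬝ᵥ w.1 + δ := by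
  obtain ⟨lam, R⟩ := w
  obtain ⟨hlam, ⟨hR, hRτ⟩, hlamR⟩ := hw
  set p : 𝒳 × 𝒴 → ℝ := fun s => m s.1 * k s.2 with hp
  have hpmem : p ∈ stdSimplex ℝ (𝒳 × 𝒴) := (product_mem_couplings hm hk).1
  have hp0 : ∀ s, 0 < p s := fun s => mul_pos (hm0 _) (hk0 _)
  have hI : ∀ s, indep P Q s ∈ couplings (P s.1) (Q s.2) := fun s =>
    product_mem_couplings (hP s.1) (hQ s.2)
  set D : ℝ := |c ⬝ᵥ p - c ⬝ᵥ lam| with hD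
  -- The cost changes by `ε * (c ⬝ᵥ p - c ⬝ᵥ lam)`, at most `ε * (D + 1) ≤ δ`; the bound `1 / 2`
  -- keeps `ε < 1`.
  set ε : ℝ := min (1 / 2) (δ / (D + 1)) with hε
  have hD1 : 0 < D + 1 := by positivity
  have hε0 : 0 < ε := lt_min (by norm_num) (div_pos hδ hD1)
  have hε1 : ε < 1 := (min_le_left _ _).trans_lt (by norm_num)
  have hεD : ε * (D + 1) ≤ δ := (le_div_iff₀ hD1).1 (min_le_right _ _)
  set lam' : 𝒳 × 𝒴 → ℝ := fun s => (1 - ε) * lam s + ε * p s with hlam'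
  have hlam'0 : ∀ s, 0 < lam' s := fun s =>
    add_pos_of_nonneg_of_pos (mul_nonneg (sub_pos.2 hε1).le (hlam.1 s)) (mul_pos hε0 (hp0 s))
  -- The constraint is bilinear in `(lam, R)` but linear in the flow. The row-dependent weight makes
  -- `lam' s * R' s t` the `ε`-mixture of the two flows, so `lam'` is stationary.
  set θ : 𝒳 × 𝒴 → ℝ := fun s => ε * p s / lam' s with hθ
  have hθ0 : ∀ s, 0 < θ s := fun s => div_pos (mul_pos hε0 (hp0 s)) (hlam'0 s)
  have hθ1 : ∀ s, θ s ≤ 1 := fun s => by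
    rw [hθ, div_le_one (hlam'0 s)]
    exact le_add_of_nonneg_left (mul_nonneg (sub_pos.2 hε1).le (hlam.1 s))
  have hθl : ∀ s, lam' s * θ s = ε * p s := fun s => mul_div_cancel₀ _ (hlam'0 s).ne'
  set R' : Matrix (𝒳 × 𝒴) (𝒳 × 𝒴) ℝ := fun s t => (1 - θ s) * R s t + θ s * indep P Q s t
    with hR'
  refine ⟨(lam', R'), ⟨convex_stdSimplex ℝ _ hlam hpmem (sub_pos.2 hε1).le hε0.le (by ring),
    fun s => couplings_mix_mem (hR s) (hI s) (hθ0 s).le (hθ1 s), ?_⟩, hlam'0, fun s => ?_,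
    fun s t hst => ?_, ?_⟩
  · ext t
    have h1 : ∑ s, lam s * R s t = lam t := congrFun hlamR t
    have h2 : ∑ s, p s * indep P Q s t = p t := congrFun (product_vecMul_indep hmP hkQ) t
    show ∑ s, lam' s * R' s t = (1 - ε) * lam t + ε * p t
    rw [← h1, ← h2, Finset.mul_sum, Finset.mul_sum, ← Finset.sum_add_distrib]
    refine Finset.sum_congr rfl fun s _ => ?_
    have e : lam' s * R' s t =
        (lam' s - lam' s * θ s) * R s t + lam' s * θ s * indep P Q s t := by
      simp only [hR']
      ring
    rw [e, hθl]
    simp only [hlam']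
    ring
  · have hle := klSum_mix_le (hR s).1.1 (hI s).1.1 (fun t ht => couplings_eq_zero (hR s) ht)
      (hθ0 s).le (hθ1 s)
    refine (EReal.coe_le_coe_iff.2 hle).trans_lt ?_
    -- Strictness uses both `θ s > 0` and `τ > 0`.
    refine coe_mul_lt_of_coe_le hτ ?_ (sub_nonneg.2 (hθ1 s)) (sub_lt_self _ (hθ0 s))
    rw [← klVec_row_eq hR]
    exact hRτ s
  · exact add_pos_of_nonneg_of_pos (mul_nonneg (sub_nonneg.2 (hθ1 s)) ((hR s).1.1 t))
      (mul_pos (hθ0 s) (lt_of_le_of_ne ((hI s).1.1 t) hst.symm))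
  · have e : c ⬝ᵥ lam' = c ⬝ᵥ lam + ε * (c ⬝ᵥ p - c ⬝ᵥ lam) := by
      have : lam' = (1 - ε) • lam + ε • p := rfl
      rw [this, dotProduct_add, dotProduct_smul, dotProduct_smul, smul_eq_mul, smul_eq_mul]
      ring
    show c ⬝ᵥ lam' ≤ c ⬝ᵥ lam + δ
    rw [e]
    have : ε * (c ⬝ᵥ p - c ⬝ᵥ lam) ≤ ε * (D + 1) :=
      mul_le_mul_of_nonneg_left ((le_abs_self _).trans (le_add_of_nonneg_right zero_le_one)) hε0.le
    linarith

/-- Half of `δ` pays for the move to the interior, half for replacing the interior pair by `(ν n, Rn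
n)`; the strict divergence bounds survive by continuity. -/
lemma costsApproximable_klTransitionCouplings (c : 𝒳 × 𝒴 → ℝ) {τ : EReal} (hτ : 0 < τ)
    (hP : StochasticApprox Pn P) (hQ : StochasticApprox Qn Q) :
    CostsApproximable c (fun n => klTransitionCouplings τ (Pn n) (Qn n))
      (klTransitionCouplings τ P Q) := by
  intro w hw δ hδ
  obtain ⟨m, hm, hm0, hmP⟩ := hP.exists_stationary
  obtain ⟨k, hk, hk0, hkQ⟩ := hQ.exists_stationary
  obtain ⟨⟨lam, R⟩, ⟨hlam, hR, hlamR⟩, hpos, hkl, hfull, hcost⟩ :=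
    exists_interior_feasible c hτ hP.stochastic hQ.stochastic hm hk hm0 hk0 hmP hkQ hw
      (half_pos hδ)
  dsimp only at hlam hR hlamR hpos hkl hfull hcost
  set Rn : ℕ → Matrix (𝒳 × 𝒴) (𝒳 × 𝒴) ℝ := fun n s =>
    adjustMarginals (P s.1) (Pn n s.1) (Q s.2) (Qn n s.2) (R s) with hRn
  have hRnlim : Tendsto Rn atTop (𝓝 R) := tendsto_pi_nhds.2 fun s =>
    tendsto_adjustMarginals (R s) (hP.tendsto_row s.1) (hQ.tendsto_row s.2)
  have hRnmem : ∀ᶠ n in atTop, Rn n ∈ transitionCouplings (Pn n) (Qn n) := by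
    refine eventually_all.2 fun s => ?_
    refine eventually_adjustMarginals_mem (hP.tendsto_row s.1) (hQ.tendsto_row s.2) ?_ ?_
      (hP.stochastic s.1) (hQ.stochastic s.2) (hR s) fun x y hxy => hfull s (x, y) hxy
    · filter_upwards [hP.eventually_stochastic, hP.eventually_support] with n h1 h2
      exact ⟨h1 _, h2 _⟩
    · filter_upwards [hQ.eventually_stochastic, hQ.eventually_support] with n h1 h2
      exact ⟨h1 _, h2 _⟩
  have hsupp : ∀ᶠ n in atTop, ∀ s t, indep P Q s t = 0 → Rn n s t = 0 := by
    filter_upwards [hRnmem, eventually_transitionCouplings_support hP hQ] with n h1 h2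
    exact h2 _ h1
  obtain ⟨ν, hνlim, hν⟩ := exists_tendsto_stationary hRnlim
    (by
      filter_upwards [hRnmem, hsupp] with n h1 h2
      refine ⟨fun s => (h1 s).1, fun s t hst => h2 s t ?_⟩
      by_contra h
      exact (hfull s t h).ne' hst)
    (fun s => (hR s).1) hlam hpos hlamR
  have hklτ : ∀ᶠ n in atTop, ∀ s, (klSum (Rn n s) (indep (Pn n) (Qn n) s) : EReal) < τ := by
    refine eventually_all.2 fun s => ?_
    have h := tendsto_klSum (tendsto_pi_nhds.1 hRnlim s)
      (tendsto_indep hP.tendsto hQ.tendsto s) (hsupp.mono fun n hn => hn s)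
    exact ((continuous_coe_real_ereal.tendsto _).comp h).eventually_lt_const (hkl s)
  have hcostlim : Tendsto (fun n => c ⬝ᵥ ν n) atTop (𝓝 (c ⬝ᵥ lam)) := by
    have hcont : Continuous fun v : 𝒳 × 𝒴 → ℝ => c ⬝ᵥ v := by
      unfold dotProduct
      fun_prop
    exact (hcont.tendsto lam).comp hνlim
  filter_upwards [hRnmem, hν, hklτ,
    hcostlim.eventually_lt_const (lt_add_of_pos_right _ (half_pos hδ))] with n h1 h2 h3 h4
  refine ⟨(ν n, Rn n), ⟨h2.1, ⟨h1, fun s => ?_⟩, h2.2⟩, ?_⟩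
  · rw [klVec_row_eq h1]
    exact (h3 s).le
  · show c ⬝ᵥ ν n ≤ c ⬝ᵥ w.1 + δ
    linarith

lemma klTransitionCouplings_stochastic {τ : EReal} {P : Matrix 𝒳 𝒳 ℝ} {Q : Matrix 𝒴 𝒴 ℝ} :
    ∀ R ∈ klTransitionCouplings τ P Q, ∀ s, R s ∈ stdSimplex ℝ (𝒳 × 𝒴) :=
  fun _ hR s => (hR.1 s).1

/-- A vanishing row of `P` makes the program infeasible. -/
lemma klTransitionCouplings_eq_empty_left [Nonempty 𝒴] {τ : EReal} {P : Matrix 𝒳 𝒳 ℝ}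
    {Q : Matrix 𝒴 𝒴 ℝ} {x : 𝒳} (hx : ∀ x', P x x' = 0) : klTransitionCouplings τ P Q = ∅ := by
  refine Set.eq_empty_iff_forall_notMem.2 fun R hR => ?_
  obtain ⟨y⟩ := ‹Nonempty 𝒴›
  have h := (hR.1 (x, y)).1.2
  rw [Finset.sum_eq_zero fun t _ =>
    couplings_eq_zero (hR.1 (x, y)) (x := t.1) (y := t.2) (by rw [hx, zero_mul])] at h
  exact zero_ne_one h

/-- A vanishing row of `Q` makes the program infeasible. -/
lemma klTransitionCouplings_eq_empty_right [Nonempty 𝒳] {τ : EReal} {P : Matrix 𝒳 𝒳 ℝ}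
    {Q : Matrix 𝒴 𝒴 ℝ} {y : 𝒴} (hy : ∀ y', Q y y' = 0) : klTransitionCouplings τ P Q = ∅ := by
  refine Set.eq_empty_iff_forall_notMem.2 fun R hR => ?_
  obtain ⟨x⟩ := ‹Nonempty 𝒳›
  have h := (hR.1 (x, y)).1.2
  rw [Finset.sum_eq_zero fun t _ =>
    couplings_eq_zero (hR.1 (x, y)) (x := t.1) (y := t.2) (by rw [hy, mul_zero])] at h
  exact zero_ne_one h

/-- The sequence `Pn` either approximates `P` or has, like `P`, a vanishing row. -/
def ApproxOrDegenerate (Pn : ℕ → Matrix 𝒳 𝒳 ℝ) (P : Matrix 𝒳 𝒳 ℝ) : Prop :=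
  StochasticApprox Pn P ∨ ∃ x, (∀ x', P x x' = 0) ∧ ∀ n x', Pn n x x' = 0

/-- A common vanishing row makes all the programs infeasible, and both stability conditions are then
vacuous. -/
theorem optimal_klTransitionCouplings_stable [Nonempty 𝒳] [Nonempty 𝒴] (c : 𝒳 × 𝒴 → ℝ)
    {τ : EReal} (hτ : 0 < τ) (hP : ApproxOrDegenerate Pn P) (hQ : ApproxOrDegenerate Qn Q) :
    Tendsto (fun n => optimalValue c (klTransitionCouplings τ (Pn n) (Qn n))) atTop
        (𝓝 (optimalValue c (klTransitionCouplings τ P Q))) ∧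
      setLimsup (fun n => optimalSolutions c (klTransitionCouplings τ (Pn n) (Qn n))) ⊆
        optimalSolutions c (klTransitionCouplings τ P Q) := by
  have hdeg : klTransitionCouplings τ P Q = ∅ → (∀ n, klTransitionCouplings τ (Pn n) (Qn n) = ∅) →
      LimitsFeasible (fun n => klTransitionCouplings τ (Pn n) (Qn n))
        (klTransitionCouplings τ P Q) ∧
      CostsApproximable c (fun n => klTransitionCouplings τ (Pn n) (Qn n))
        (klTransitionCouplings τ P Q) := by
    intro h hn
    refine ⟨fun φ z w _ hz _ => ?_, fun w hw => ?_⟩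
    · have := (hz 0).2.1
      simp only [hn, Set.mem_empty_iff_false] at this
    · have := hw.2.1
      simp only [h, Set.mem_empty_iff_false] at this
  have hmain : LimitsFeasible (fun n => klTransitionCouplings τ (Pn n) (Qn n))
        (klTransitionCouplings τ P Q) ∧
      CostsApproximable c (fun n => klTransitionCouplings τ (Pn n) (Qn n))
        (klTransitionCouplings τ P Q) := by
    rcases hP with hP | ⟨x, hx, hxn⟩
    · rcases hQ with hQ | ⟨y, hy, hyn⟩
      · exact ⟨limitsFeasible_klTransitionCouplings τ hP hQ,
          costsApproximable_klTransitionCouplings c hτ hP hQ⟩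
      · exact hdeg (klTransitionCouplings_eq_empty_right hy)
          fun n => klTransitionCouplings_eq_empty_right (hyn n)
    · exact hdeg (klTransitionCouplings_eq_empty_left hx)
        fun n => klTransitionCouplings_eq_empty_left (hxn n)
  exact ⟨tendsto_optimalValue (fun _ => klTransitionCouplings_stochastic) hmain.1 hmain.2,
    setLimsup_optimalSolutions_subset hmain.1 hmain.2⟩

end Stability

end OTC

namespace OTC

/-! ### Empirical transition matrices of a stationary ergodic process. -/

section Observations

variable {Ω 𝒳 : Type*}

lemma shift_iterate_apply (u : ℕ → 𝒳) (i j : ℕ) : shift^[i] u j = u (j + i) := by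
  induction i generalizing u with
  | zero => rfl
  | succ i ih =>
    rw [Function.iterate_succ_apply, ih]
    exact congrArg u (by omega)

variable [MeasurableSpace Ω] [MeasurableSpace 𝒳] {μ : Measure Ω} {X : ℕ → Ω → 𝒳}

lemma ae_tendsto_frequency [IsProbabilityMeasure μ] (hXm : ∀ i, Measurable (X i))
    (hX : StationaryErgodic μ X) (p : (ℕ → 𝒳) → Prop) [DecidablePred p]
    (hp : MeasurableSet {u | p u}) :
    ∀ᵐ ω ∂μ, Tendsto (fun n : ℕ =>
      (((Finset.range n).filter fun i => p (shift^[i] fun j => X j ω)).card : ℝ) / n) atTop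
      (𝓝 (μ.real {ω | p fun j => X j ω})) := by
  have hpath : Measurable fun ω i => X i ω := measurable_pi_lambda _ hXm
  have : IsProbabilityMeasure (μ.map fun ω i => X i ω) :=
    Measure.isProbabilityMeasure_map hpath.aemeasurable
  have h := ae_tendsto_birkhoffSum_div hX (f := Set.indicator {u | p u} 1)
    (measurable_one.indicator hp) ((integrable_const (1 : ℝ)).indicator hp)
  filter_upwards [ae_of_ae_map hpath.aemeasurable h] with ω hω
  rw [integral_indicator_one hp, map_measureReal_apply hpath hp] at hω
  refine hω.congr fun n => ?_
  congr 1
  simp [birkhoffSum, Set.indicator_apply, Finset.sum_boole]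

/-- Stationarity gives every shift of the event probability zero, and there are countably many.
Frequency limits alone would not exclude rare occurrences. -/
lemma ae_forall_not [IsProbabilityMeasure μ] (hXm : ∀ i, Measurable (X i))
    (hX : StationaryErgodic μ X) (p : (ℕ → 𝒳) → Prop) (hp : MeasurableSet {u | p u})
    (h0 : μ.real {ω | p fun j => X j ω} = 0) :
    ∀ᵐ ω ∂μ, ∀ i, ¬ p (shift^[i] fun j => X j ω) := by
  have hpath : Measurable fun ω i => X i ω := measurable_pi_lambda _ hXm
  have h1 : ∀ᵐ u ∂μ.map fun ω i => X i ω, ¬ p u := by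
    refine (ae_map_iff hpath.aemeasurable hp.compl).2 ?_
    rw [ae_iff]
    simpa [measureReal_eq_zero_iff] using h0
  refine ae_all_iff.2 fun i => ?_
  have h2 := (hX.toMeasurePreserving.iterate i).quasiMeasurePreserving.ae h1
  exact ae_of_ae_map hpath.aemeasurable h2

lemma measureReal_coord_one [MeasurableSingletonClass 𝒳] (hXm : ∀ i, Measurable (X i))
    (hX : StationaryErgodic μ X) (x : 𝒳) :
    μ.real {ω | X 1 ω = x} = μ.real {ω | X 0 ω = x} := by
  have hpath : Measurable fun ω i => X i ω := measurable_pi_lambda _ hXm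
  have hA : MeasurableSet {u : ℕ → 𝒳 | u 0 = x} :=
    (measurable_pi_apply 0 : Measurable fun u : ℕ → 𝒳 => u 0) (measurableSet_singleton x)
  have h := hX.toMeasurePreserving.measureReal_preimage hA.nullMeasurableSet
  rw [map_measureReal_apply hpath hA,
    map_measureReal_apply hpath (hX.toMeasurePreserving.measurable hA)] at h
  exact h

lemma sum_measureReal_fiber_inter [IsFiniteMeasure μ] [Fintype 𝒳] [MeasurableSingletonClass 𝒳]
    {Z : Ω → 𝒳} (hZ : Measurable Z) (B : Set Ω) :
    ∑ x, μ.real {ω | Z ω = x ∧ ω ∈ B} = μ.real B := by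
  have h := sum_measureReal_preimage_singleton (μ := μ.restrict B) Finset.univ (f := Z)
    (fun x _ => hZ (measurableSet_singleton x))
  simp only [Finset.coe_univ, Set.preimage_univ, measureReal_restrict_apply MeasurableSet.univ,
    Set.univ_inter] at h
  rw [← h]
  refine Finset.sum_congr rfl fun x _ => ?_
  rw [measureReal_restrict_apply (hZ (measurableSet_singleton x))]
  rfl

omit [MeasurableSpace 𝒳] in
lemma sum_card_transitions [Fintype 𝒳] [DecidableEq 𝒳] (u : ℕ → 𝒳) (n : ℕ) (x : 𝒳) :
    ∑ x', ((Finset.range n).filter fun i => u i = x ∧ u (i + 1) = x').card =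
      ((Finset.range n).filter fun i => u i = x).card := by
  rw [Finset.card_eq_sum_card_fiberwise (f := fun i => u (i + 1)) (t := Finset.univ)
    fun _ _ => Finset.mem_coe.2 (Finset.mem_univ _)]
  simp only [Finset.filter_filter]

/-- The empirical transition matrices of a stationary ergodic process almost surely approximate
its transition matrix, or both have a vanishing row. -/
theorem ae_approxOrDegenerate_empiricalMatrix [IsProbabilityMeasure μ] [Fintype 𝒳]
    [DecidableEq 𝒳] [MeasurableSingletonClass 𝒳] (hXm : ∀ i, Measurable (X i))
    (hX : StationaryErgodic μ X) :
    ∀ᵐ ω ∂μ, ApproxOrDegenerate (fun n => empiricalMatrix (fun i => X i ω) n)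
      (oneStepMatrix μ X) := by
  have hA : ∀ (x : 𝒳) (j : ℕ), MeasurableSet {u : ℕ → 𝒳 | u j = x} := fun x j =>
    (measurable_pi_apply j : Measurable fun u : ℕ → 𝒳 => u j) (measurableSet_singleton x)
  have hB : ∀ x x' : 𝒳, MeasurableSet {u : ℕ → 𝒳 | u 0 = x ∧ u 1 = x'} := fun x x' =>
    (hA x 0).inter (hA x' 1)
  -- A state of probability zero is almost surely never visited, so by `0 / 0 = 0` its row vanishes
  -- in both the true and the empirical matrices.
  by_cases hdeg : ∃ x, μ.real {ω | X 0 ω = x} = 0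
  · obtain ⟨x, hx⟩ := hdeg
    filter_upwards [ae_forall_not hXm hX (fun u => u 0 = x) (hA x 0) hx] with ω hω
    refine Or.inr ⟨x, fun x' => ?_, fun n x' => ?_⟩
    · rw [oneStepMatrix, hx, div_zero]
    · have h : (Finset.range (n - 1)).filter (fun i => X i ω = x) = ∅ := by
        refine Finset.filter_eq_empty_iff.2 fun i _ => ?_
        have := hω i
        rwa [shift_iterate_apply, zero_add] at this
      simp only [empiricalMatrix, h, Finset.card_empty, Nat.cast_zero, div_zero]
  · push Not at hdeg
    have hpos : ∀ x, 0 < μ.real {ω | X 0 ω = x} := fun x =>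
      measureReal_nonneg.lt_of_ne (hdeg x).symm
    have h1 := ae_all_iff.2 fun x => ae_tendsto_frequency hXm hX (fun u => u 0 = x) (hA x 0)
    have h2 := ae_all_iff.2 fun x => ae_all_iff.2 fun x' =>
      ae_tendsto_frequency hXm hX (fun u => u 0 = x ∧ u 1 = x') (hB x x')
    have h3 : ∀ᵐ ω ∂μ, ∀ x x', oneStepMatrix μ X x x' = 0 →
        ∀ i, ¬ (X i ω = x ∧ X (i + 1) ω = x') := by
      refine ae_all_iff.2 fun x => ae_all_iff.2 fun x' => ?_
      by_cases h0 : oneStepMatrix μ X x x' = 0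
      · have h0' : μ.real {ω | X 0 ω = x ∧ X 1 ω = x'} = 0 :=
          (div_eq_zero_iff.1 h0).resolve_right (hdeg x)
        filter_upwards [ae_forall_not hXm hX (fun u => u 0 = x ∧ u 1 = x') (hB x x') h0']
          with ω hω _ i
        have := hω i
        rwa [shift_iterate_apply, shift_iterate_apply, zero_add, add_comm 1 i] at this
      · exact Eventually.of_forall fun ω h => absurd h h0
    filter_upwards [h1, h2, h3] with ω h1 h2 h3
    simp only [shift_iterate_apply, zero_add, add_comm 1] at h1 h2
    have hpred : Tendsto (fun n : ℕ => n - 1) atTop atTop := tendsto_sub_atTop_nat 1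
    refine Or.inl ⟨?_, ?_, ?_, ?_⟩
    · refine tendsto_pi_nhds.2 fun x => tendsto_pi_nhds.2 fun x' => ?_
      refine (((h2 x x').comp hpred).div ((h1 x).comp hpred) (hdeg x)).congr' ?_
      filter_upwards [hpred.eventually_gt_atTop 0] with n hn
      exact div_div_div_cancel_right₀ (Nat.cast_ne_zero.2 hn.ne') _ _
    -- An empirical row is zero until the state is first visited, and sums to exactly one
    -- afterwards, since numerator and denominator count over the same `n - 1` transitions.
    · have hcount : ∀ᶠ n in atTop, ∀ x,
          (((Finset.range (n - 1)).filter fun i => X i ω = x).card : ℝ) ≠ 0 := by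
        refine eventually_all.2 fun x => ?_
        filter_upwards [((h1 x).comp hpred).eventually_ne (hdeg x)] with n hn h0
        exact hn (by rw [Function.comp_apply, h0, zero_div])
      filter_upwards [hcount] with n hn x
      refine ⟨fun x' => div_nonneg (Nat.cast_nonneg _) (Nat.cast_nonneg _), ?_⟩
      simp only [empiricalMatrix]
      rw [← Finset.sum_div, ← Nat.cast_sum, sum_card_transitions (fun i => X i ω), div_self (hn x)]
    · refine Eventually.of_forall fun n x x' h0 => ?_
      simp only [empiricalMatrix]
      rw [Finset.filter_eq_empty_iff.2 fun i _ => h3 x x' h0 i,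
        Finset.card_empty, Nat.cast_zero, zero_div]
    -- The law of `X 0` is stationary for the one-step matrix, without any Markov property.
    · refine ⟨fun x => μ.real {ω | X 0 ω = x}, ⟨fun x => measureReal_nonneg, ?_⟩, hpos, ?_⟩
      · have := sum_measureReal_fiber_inter (μ := μ) (hXm 0) Set.univ
        simpa using this
      · ext x'
        show ∑ x, μ.real {ω | X 0 ω = x} * oneStepMatrix μ X x x' = μ.real {ω | X 0 ω = x'}
        rw [← measureReal_coord_one hXm hX x',
          ← sum_measureReal_fiber_inter (hXm 0) {ω | X 1 ω = x'}]
        exact Finset.sum_congr rfl fun x _ => mul_div_cancel₀ _ (hdeg x)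

end Observations

end OTC

theorem mainTheorem3 {Ω 𝒳 𝒴 : Type*} [MeasurableSpace Ω]
    [Fintype 𝒳] [DecidableEq 𝒳] [MeasurableSpace 𝒳] [MeasurableSingletonClass 𝒳]
    [Fintype 𝒴] [DecidableEq 𝒴] [MeasurableSpace 𝒴] [MeasurableSingletonClass 𝒴]
    (μ : Measure Ω) [IsProbabilityMeasure μ] (c : 𝒳 × 𝒴 → ℝ)
    (X : ℕ → Ω → 𝒳) (Y : ℕ → Ω → 𝒴)
    (hXm : ∀ i, Measurable (X i)) (hYm : ∀ i, Measurable (Y i))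
    (hX : OTC.StationaryErgodic μ X) (hY : OTC.StationaryErgodic μ Y)
    (P : Matrix 𝒳 𝒳 ℝ) (Q : Matrix 𝒴 𝒴 ℝ)
    (hP : P = OTC.oneStepMatrix μ X) (hQ : Q = OTC.oneStepMatrix μ Y)
    (Phat : ℕ → Ω → Matrix 𝒳 𝒳 ℝ) (Qhat : ℕ → Ω → Matrix 𝒴 𝒴 ℝ)
    (hPhat : ∀ n ω, Phat n ω = OTC.empiricalMatrix (fun i => X i ω) n)
    (hQhat : ∀ n ω, Qhat n ω = OTC.empiricalMatrix (fun i => Y i ω) n) :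
    ∀ᵐ ω ∂μ,
      (Tendsto (fun n => OTC.rho c (Phat n ω) (Qhat n ω)) atTop (𝓝 (OTC.rho c P Q)) ∧
        OTC.setLimsup (fun n => OTC.PhiStar c (Phat n ω) (Qhat n ω)) ⊆ OTC.PhiStar c P Q) ∧
      ∀ η : ℝ, 0 < η →
        Tendsto (fun n => OTC.rhoEta c η (Phat n ω) (Qhat n ω)) atTop
            (𝓝 (OTC.rhoEta c η P Q)) ∧
          OTC.setLimsup (fun n => OTC.PhiStarEta c η (Phat n ω) (Qhat n ω)) ⊆
            OTC.PhiStarEta c η P Q := by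
  obtain ⟨ω₀⟩ : Nonempty Ω := nonempty_of_isProbabilityMeasure μ
  have : Nonempty 𝒳 := ⟨X 0 ω₀⟩
  have : Nonempty 𝒴 := ⟨Y 0 ω₀⟩
  filter_upwards [OTC.ae_approxOrDegenerate_empiricalMatrix hXm hX,
    OTC.ae_approxOrDegenerate_empiricalMatrix hYm hY] with ω hωX hωY
  simp only [← hPhat, ← hQhat, ← hP, ← hQ] at hωX hωY
  -- The stability theorem applies path by path, so one null set serves all `η`.
  refine ⟨?_, fun η hη =>
    OTC.optimal_klTransitionCouplings_stable c (EReal.coe_pos.2 hη) hωX hωY⟩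
  have h := OTC.optimal_klTransitionCouplings_stable c EReal.zero_lt_top hωX hωY
  simp only [OTC.klTransitionCouplings_top] at h
  exact h
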